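/- Let $P_1,P_2$ be probability distributions on the alphabet $\mathcal Y=\{0,1,2,\dots\}$ and let $w(1),w(2)>0$ with $w(1)+w(2)=1$. For $i=1,2$ let $Y_i$ have distribution $P_i$, let $$H(Y_i)=\sum_{y}P_i(y)\log\frac1{P_i(y)},\qquad \sigma_i^2=\sum_y P_i(y)\Bigl(\log\frac1{P_i(y)}-H(Y_i)\Bigr)^2$$ (natural logarithms), where both variances are assumed to be finite. Let $\mathbf Y=\{Y^n\}_{n\ge1}$ be the mixed source $$P_{Y^n}(y_1\cdots y_n)=w(1)\prod_{k=1}^nP_1(y_k)+w(2)\prod_{k=1}^nP_2(y_k).$$ A real number $R$ is called $(a,\varepsilon)$-achievable if there are positive integers $M_n$, encoders $\varphi_n:\mathcal Y^n\to\{1,\dots,M_n\}$ and decoders $\psi_n:\{1,\dots,M_n\}\to\mathcal Y^n$ with $$\limsup_{n\to\infty}\Pr\{Y^n\ne\psi_n(\varphi_n(Y^n))\}\le\varepsilon,\qquad \limsup_{n\to\infty}\frac1{\sqrt n}\log\frac{M_n}{e^{na}}\le R,$$ and $L_f(a,\varepsilon|\mathbf Y)\in[-\infty,+\infty]$ denotes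 the infimum of all $(a,\varepsilon)$-achievable $R$ (with $\inf\emptyset=+\infty$). Put $Q(t)=\int_t^\infty\frac1{\sqrt{2\pi}}e^{-z^2/2}\,dz$ for $t\in[-\infty,+\infty]$, so that $Q(+\infty)=0$ and $Q(-\infty)=1$. Let $0\le\varepsilon<1$. Then the following holds. Case I: if $H(Y_1)=H(Y_2)$ and $\sigma_1,\sigma_2>0$, then $L_f(H(Y_1),\varepsilon|\mathbf Y)=T_7$, where $T_7\in[-\infty,+\infty]$ is the unique solution of $\varepsilon=w(1)\,Q(T_7/\sigma_1)+w(2)\,Q(T_7/\sigma_2)$. Case II: if $H(Y_1)>H(Y_2)$, $w(1)>\varepsilon$ and $\sigma_1>0$, then $L_f(H(Y_1),\varepsilon|\mathbf Y)=T_8$, where $T_8\in[-\infty,+\infty]$ is the unique solution of $\varepsilon=w(1)\,Q(T_8/\sigma_1)$. Case III: if $H(Y_1)>H(Y_2)$, $w(1)<\varepsilon$ and $\sigma_2>0$, then $L_f(H(Y_2),\varepsilon|\mathbf Y)=T_9$, where $T_9\in[-\infty,+\infty]$ is the unique solution of $\varepsilon=w(1)+w(2)\,Q(T_9/\sigma_2)$.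 -/

import Mathlib

open Filter MeasureTheory

noncomputable section

namespace FixedLengthCoding

/-! ### Self-information of a source letter over the alphabet `ℕ` (natural logarithms) -/

/-- The self-information `log (1 / P(y))` of the letter `y`.  Letters with `P(y) = 0` get the value
`0`; everywhere below this is multiplied by `P(y)`, so that the convention is immaterial. -/
def selfInfo (P : PMF ℕ) (y : ℕ) : ℝ :=
  Real.log (1 / (P y).toReal)

/-- The entropy `H(P) = ∑_y P(y) log (1 / P(y))`. -/
def entropy (P : PMF ℕ) : ℝ :=
  ∑' y, (P y).toReal * selfInfo P y

/-- The variance `∑_y P(y) (log (1 / P(y)) - H(P))²` is finite.  (This forces the series that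
defines the entropy to converge as well.) -/
def FiniteVarentropy (P : PMF ℕ) : Prop :=
  Summable fun y => (P y).toReal * (selfInfo P y - entropy P) ^ 2

/-- The variance `σ² = E (log (1 / P(Y)) - H(P))²` of the self-information. -/
def varentropy (P : PMF ℕ) : ℝ :=
  ∑' y, (P y).toReal * (selfInfo P y - entropy P) ^ 2

/-- The standard deviation `σ` of the self-information. -/
def stdDev (P : PMF ℕ) : ℝ :=
  Real.sqrt (varentropy P)

/-! ### Sources -/

/-- A general source with alphabet `ℕ`, given by the law of the block `Y^n` for each block
length `n`. -/
abbrev Source : Type :=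
  (n : ℕ) → Measure (Fin n → ℕ)

/-- The stationary memoryless source with letter distribution `P`: the law of `Y^n` is the `n`-fold
product of `P`. -/
def iidSource (P : PMF ℕ) : Source :=
  fun n => Measure.pi fun _ : Fin n => P.toMeasure

/-- The mixed source `P_{Y^n} = w₁ P_{Y₁^n} + w₂ P_{Y₂^n}`. -/
def mixedSource (w₁ w₂ : ℝ) (Y₁ Y₂ : Source) : Source :=
  fun n => ENNReal.ofReal w₁ • Y₁ n + ENNReal.ofReal w₂ • Y₂ n

/-! ### Fixed-length source coding -/

/-- A fixed-length code for blocks of length `n` with `M` codewords: an encoder and a decoder. -/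
structure Code (n M : ℕ) where
  /-- the encoder -/
  enc : (Fin n → ℕ) → Fin M
  /-- the decoder -/
  dec : Fin M → (Fin n → ℕ)

/-- The decoding error probability `Pr {Y^n ≠ ψ(φ(Y^n))}` when `Y^n` has law `μ`. -/
def Code.errorProb {n M : ℕ} (c : Code n M) (μ : Measure (Fin n → ℕ)) : ENNReal :=
  μ {y | y ≠ c.dec (c.enc y)}

/-- The real number `R` is an `(a, ε)`-achievable rate for the source `Y`: there are codes
`(n, M_n, ε_n)` with `limsup ε_n ≤ ε` and `limsup (1 / √n) log (M_n / e^{na}) ≤ R`. -/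
def Achievable (Y : Source) (a ε R : ℝ) : Prop :=
  ∃ (M : ℕ → ℕ) (c : (n : ℕ) → Code n (M n)),
    limsup (fun n : ℕ => (c n).errorProb (Y n)) atTop ≤ ENNReal.ofReal ε ∧
    limsup (fun n : ℕ =>
      ((1 / Real.sqrt n * Real.log ((M n : ℝ) / Real.exp (n * a)) : ℝ) : EReal)) atTop
        ≤ (R : EReal)

/-- The `(a, ε)`-fixed-length source coding rate `L_f(a, ε | Y)`: the infimum, taken in the extended
reals, of the `(a, ε)`-achievable rates (so it is `+∞` if there are none). -/
def codingRate (Y : Source) (a ε : ℝ) : EReal :=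
  sInf ((fun R : ℝ => (R : EReal)) '' {R : ℝ | Achievable Y a ε R})

/-! ### The Gaussian tail -/

/-- `∫_t^∞ (1 / √(2π)) exp (- z² / 2) dz` for an extended real `t`. -/
def gaussianTail (t : EReal) : ℝ :=
  ∫ z in {z : ℝ | t ≤ (z : EReal)}, 1 / Real.sqrt (2 * Real.pi) * Real.exp (-z ^ 2 / 2)

end FixedLengthCoding

end

open FixedLengthCoding

open FixedLengthCoding
namespace FixedLengthCoding

open ProbabilityTheory
open scoped Topology

/-! ### The Gaussian tail -/

/-! The self-information of the mixture itself is never needed; each component is treated under its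
own law. At most `e^t` blocks have probability at least `e^(-t)`, so listing those of both
components gives one code with `O(e^t)` words whose error under each `Pᵢ` is at most the tail `Pr
{blockInfo > t}` (`exists_code_error_le_blockInfo_tail`). Conversely, `M` decoded blocks cover at
most `M e^(-t)` of that tail, for every code and each component (`blockInfo_tail_le_error_add`).

Take `t = n a + √n γ`. Constant factors in `M` vanish at scale `√n`, so the asymptotic error at rate
`γ` is `w₁ q₁(γ) + w₂ q₂(γ)`, where `qᵢ` is the limiting tail. If `a = H(Yᵢ)`, the central limit
theorem gives `qᵢ(γ) = Q(γ/σᵢ)`; if `a` is above or below `H(Yᵢ)`, Chebyshev gives `0` or `1`. The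
sum is strictly decreasing, so the point where it equals `ε` is the coding rate
(`codingRate_mixedSource_eq`). -/

theorem gaussianTail_eq_measureReal (t : EReal) :
    gaussianTail t = (gaussianReal 0 1).real {z : ℝ | t ≤ (z : EReal)} := by
  rw [measureReal_def, gaussianReal_apply_eq_integral 0 one_ne_zero,
    ENNReal.toReal_ofReal (integral_nonneg fun _ => gaussianPDFReal_nonneg _ _ _)]
  simp [gaussianTail, gaussianPDFReal]

theorem gaussianTail_top : gaussianTail ⊤ = 0 := by
  simp [gaussianTail]

theorem gaussianTail_bot : gaussianTail ⊥ = 1 := by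
  simp [gaussianTail_eq_measureReal]

theorem gaussianTail_coe (t : ℝ) : gaussianTail (t : EReal) = (gaussianReal 0 1).real (Set.Ici t) := by
  simp [gaussianTail_eq_measureReal, Set.Ici]

theorem gaussianTail_antitone : Antitone gaussianTail := by
  intro s t hst
  rw [gaussianTail_eq_measureReal, gaussianTail_eq_measureReal]
  exact measureReal_mono fun z (hz : t ≤ (z : EReal)) => hst.trans hz

theorem gaussianTail_strictAnti : StrictAnti gaussianTail := by
  intro s t hst
  obtain ⟨x, hsx, hxt⟩ := EReal.lt_iff_exists_real_btwn.1 hst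
  obtain ⟨y, hxy, hyt⟩ := EReal.lt_iff_exists_real_btwn.1 hxt
  refine (gaussianTail_antitone hyt.le).trans_lt
    (lt_of_lt_of_le ?_ (gaussianTail_antitone hsx.le))
  have hxy' : x < y := EReal.coe_lt_coe_iff.1 hxy
  rw [gaussianTail_coe, gaussianTail_coe, ← Set.Ico_union_Ici_eq_Ici hxy'.le,
    measureReal_union (Set.disjoint_left.2 fun z hz hz' =>
      not_le.2 (Set.mem_Ico.1 hz).2 (Set.mem_Ici.1 hz')) measurableSet_Ici]
  have hpos : 0 < (gaussianReal 0 1).real (Set.Ico x y) := by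
    refine ENNReal.toReal_pos (fun h => ?_) (measure_ne_top _ _)
    have := gaussianReal_absolutelyContinuous' 0 one_ne_zero h
    simp only [Real.volume_Ico, ENNReal.ofReal_eq_zero] at this
    linarith
  linarith

theorem gaussianTail_continuous : Continuous gaussianTail := by
  have hfun : gaussianTail = fun t : EReal =>
      ∫ z, Set.indicator {z : ℝ | t ≤ (z : EReal)} (fun _ => (1 : ℝ)) z ∂(gaussianReal 0 1) := by
    ext t
    have hm : MeasurableSet {z : ℝ | t ≤ (z : EReal)} :=
      measurableSet_le measurable_const measurable_coe_real_ereal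
    rw [gaussianTail_eq_measureReal, integral_indicator_const _ hm]
    simp
  rw [hfun, continuous_iff_continuousAt]
  intro t
  refine continuousAt_of_dominated (bound := fun _ => 1) (Eventually.of_forall fun s => ?_)
    (Eventually.of_forall fun s => Eventually.of_forall fun z => ?_) (by simp) ?_
  · exact (measurable_const.indicator
      (measurableSet_le measurable_const measurable_coe_real_ereal)).aestronglyMeasurable
  · by_cases h : z ∈ {z : ℝ | s ≤ (z : EReal)} <;> simp [h]
  · have := nullSingletonClass_gaussianReal (μ := 0) (v := 1) one_ne_zero
    -- For fixed `z` the indicator is locally constant in the threshold except at `z` itself, and a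
    -- single point is Gaussian-null.
    have hne : ∀ᵐ z ∂(gaussianReal 0 1), t ≠ ((z : ℝ) : EReal) := by
      rw [ae_iff]
      refine measure_mono_null (t := {t.toReal}) (fun z hz => ?_) (measure_singleton _)
      simp only [Set.mem_ofPred_eq, not_not, ne_eq] at hz
      simp [hz]
    filter_upwards [hne] with z hz
    rcases lt_or_gt_of_ne hz with h | h
    · refine (continuousAt_const (y := (1 : ℝ))).congr ?_
      filter_upwards [Iio_mem_nhds h] with s hs
      exact (Set.indicator_of_mem (s := {z : ℝ | s ≤ (z : EReal)})
        (Set.mem_ofPred.2 (le_of_lt hs)) fun _ => (1 : ℝ)).symm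
    · refine (continuousAt_const (y := (0 : ℝ))).congr ?_
      filter_upwards [Ioi_mem_nhds h] with s hs
      exact (Set.indicator_of_notMem (s := {z : ℝ | s ≤ (z : EReal)})
        (fun h' => not_le.2 hs (Set.mem_ofPred.1 h')) fun _ => (1 : ℝ)).symm

theorem continuous_ereal_div_coe {σ : ℝ} (hσ : 0 < σ) :
    Continuous fun T : EReal => T / (σ : EReal) := by
  simp only [EReal.div_eq_inv_mul, ← EReal.coe_inv]
  have h0 : ((σ⁻¹ : ℝ) : EReal) ≠ 0 := by simpa using hσ.ne'
  refine continuous_iff_continuousAt.2 fun T => ?_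
  exact (EReal.continuousAt_mul (p := (((σ⁻¹ : ℝ) : EReal), T)) (Or.inl h0) (Or.inl h0)
    (Or.inl (EReal.coe_ne_bot _)) (Or.inl (EReal.coe_ne_top _))).comp
    (f := fun T : EReal => (((σ⁻¹ : ℝ) : EReal), T)) (by fun_prop)

theorem gaussianTail_div_strictAnti {σ : ℝ} (hσ : 0 < σ) :
    StrictAnti fun T : EReal => gaussianTail (T / (σ : EReal)) := by
  intro s t hst
  exact gaussianTail_strictAnti
    (EReal.strictMono_div_right_of_pos (EReal.coe_pos.2 hσ) (EReal.coe_ne_top σ) hst)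

theorem gaussianTail_div_continuous {σ : ℝ} (hσ : 0 < σ) :
    Continuous fun T : EReal => gaussianTail (T / (σ : EReal)) :=
  gaussianTail_continuous.comp (continuous_ereal_div_coe hσ)

/-- Intermediate values on the connected space `EReal`. Including `±∞` covers the extreme levels,
such as `ε = 0` at `T = ⊤`. -/
theorem existsUnique_eq_of_strictAnti {G : EReal → ℝ} (hc : Continuous G) (ha : StrictAnti G)
    {ε : ℝ} (htop : G ⊤ ≤ ε) (hbot : ε ≤ G ⊥) : ∃! T, ε = G T := by
  obtain ⟨T, hT⟩ := mem_range_of_exists_le_of_exists_ge hc ⟨⊤, htop⟩ ⟨⊥, hbot⟩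
  exact ⟨T, hT.symm, fun S hS => ha.injective (hS.symm.trans hT.symm)⟩

theorem gaussianTail_top_div {σ : ℝ} (hσ : 0 < σ) : gaussianTail (⊤ / (σ : EReal)) = 0 := by
  rw [EReal.top_div_of_pos_ne_top (EReal.coe_pos.2 hσ) (EReal.coe_ne_top σ), gaussianTail_top]

theorem gaussianTail_bot_div {σ : ℝ} (hσ : 0 < σ) : gaussianTail (⊥ / (σ : EReal)) = 1 := by
  rw [EReal.bot_div_of_pos_ne_top (EReal.coe_pos.2 hσ) (EReal.coe_ne_top σ), gaussianTail_bot]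

/-! ### Codes and the information spectrum -/

theorem Code.pos {n M : ℕ} (c : Code n M) : 0 < M :=
  (c.enc 0).pos

theorem exists_code_of_finset {n : ℕ} (F : Finset (Fin n → ℕ)) (hF : F.Nonempty) :
    ∃ c : Code n F.card, ∀ y ∈ F, c.dec (c.enc y) = y := by
  classical
  obtain ⟨y₀, hy₀⟩ := hF
  refine ⟨⟨fun y => if h : y ∈ F then F.equivFin ⟨y, h⟩ else F.equivFin ⟨y₀, hy₀⟩,
    fun m => (F.equivFin.symm m : Fin n → ℕ)⟩, fun y hy => ?_⟩
  simp [hy]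

theorem card_mul_le_one {α : Type*} [MeasurableSpace α] [MeasurableSingletonClass α]
    (μ : Measure α) [IsProbabilityMeasure μ] {c : ℝ} (F : Finset α)
    (hF : ∀ y ∈ F, c ≤ μ.real {y}) : F.card * c ≤ 1 := by
  calc (F.card : ℝ) * c = ∑ _y ∈ F, c := by simp
    _ ≤ ∑ y ∈ F, μ.real {y} := Finset.sum_le_sum hF
    _ = μ.real (F : Set α) := sum_measureReal_singleton F
    _ ≤ 1 := measureReal_le_one

theorem exists_finset_mem_iff_le_measureReal {α : Type*} [MeasurableSpace α]
    [MeasurableSingletonClass α] (μ : Measure α) [IsProbabilityMeasure μ] {c : ℝ} (hc : 0 < c) :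
    ∃ F : Finset α, ∀ y, y ∈ F ↔ c ≤ μ.real {y} := by
  have hfin : {y | c ≤ μ.real {y}}.Finite := by
    by_contra hinf
    obtain ⟨k, hk⟩ := exists_nat_gt (1 / c)
    obtain ⟨F, hF, rfl⟩ := Set.Infinite.exists_subset_card_eq hinf k
    have := card_mul_le_one μ F fun y hy => hF hy
    rw [div_lt_iff₀ hc] at hk
    linarith
  exact ⟨hfin.toFinset, by simp⟩

/-- The self-information of a block under the memoryless source `P`. -/
noncomputable def blockInfo (P : PMF ℕ) {n : ℕ} (y : Fin n → ℕ) : ℝ :=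
  ∑ k, selfInfo P (y k)

instance (P : PMF ℕ) (n : ℕ) : IsProbabilityMeasure (iidSource P n) := by
  unfold iidSource; infer_instance

theorem iidSource_real_singleton (P : PMF ℕ) {n : ℕ} (y : Fin n → ℕ) :
    (iidSource P n).real {y} = ∏ k, (P (y k)).toReal := by
  simp [iidSource, measureReal_def, Measure.pi_singleton, PMF.toMeasure_apply_singleton,
    ENNReal.toReal_prod]

theorem iidSource_real_singleton_eq_exp (P : PMF ℕ) {n : ℕ} (y : Fin n → ℕ)
    (hy : ∀ k, P (y k) ≠ 0) : (iidSource P n).real {y} = Real.exp (-blockInfo P y) := by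
  rw [iidSource_real_singleton, blockInfo, ← Finset.sum_neg_distrib, Real.exp_sum]
  refine Finset.prod_congr rfl fun k _ => ?_
  have : 0 < (P (y k)).toReal := ENNReal.toReal_pos (hy k) (P.apply_ne_top _)
  rw [selfInfo, one_div, Real.log_inv, neg_neg, Real.exp_log this]

theorem iidSource_real_singleton_le (P : PMF ℕ) {n : ℕ} (y : Fin n → ℕ) :
    (iidSource P n).real {y} ≤ Real.exp (-blockInfo P y) := by
  by_cases hy : ∀ k, P (y k) ≠ 0
  · exact (iidSource_real_singleton_eq_exp P y hy).le
  · push Not at hy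
    obtain ⟨k, hk⟩ := hy
    rw [iidSource_real_singleton, Finset.prod_eq_zero (Finset.mem_univ k) (by simp [hk])]
    positivity

/-- Since `selfInfo` is `0` on letters of probability zero, a small `blockInfo` does not by itself
mean a large probability; the exceptional blocks form this null set. -/
theorem iidSource_ae_ne_zero (P : PMF ℕ) (n : ℕ) :
    iidSource P n {y | ¬ ∀ k, P (y k) ≠ 0} = 0 := by
  rw [← Set.biUnion_of_singleton {y : Fin n → ℕ | ¬ ∀ k, P (y k) ≠ 0},
    measure_biUnion_null_iff (Set.to_countable _)]
  intro y hy
  simp only [ne_eq, Set.mem_ofPred_eq, not_forall, not_not] at hy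
  obtain ⟨k, hk⟩ := hy
  rw [← measureReal_eq_zero_iff, iidSource_real_singleton]
  exact Finset.prod_eq_zero (Finset.mem_univ k) (by simp [hk])

/-- Converse bound: a correctly decoded block is one of the `M` values of the decoder, and each such
value in the tail has mass at most `e^(-t)`. -/
theorem blockInfo_tail_le_error_add (P : PMF ℕ) {n M : ℕ} (c : Code n M) (t : ℝ) :
    (iidSource P n).real {y | t < blockInfo P y} ≤
      (iidSource P n).real {y | y ≠ c.dec (c.enc y)} + M * Real.exp (-t) := by
  have hsub : {y : Fin n → ℕ | t < blockInfo P y} ⊆ {y | y ≠ c.dec (c.enc y)} ∪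
      ⋃ m : Fin M, ({c.dec m} ∩ {y | t < blockInfo P y}) := by
    intro y hy
    by_cases h : y = c.dec (c.enc y)
    · exact Or.inr (Set.mem_iUnion.2 ⟨c.enc y, h, hy⟩)
    · exact Or.inl h
  refine (measureReal_mono hsub).trans ((measureReal_union_le _ _).trans ?_)
  refine add_le_add le_rfl ((measureReal_iUnion_fintype_le _).trans ?_)
  calc ∑ m : Fin M, (iidSource P n).real ({c.dec m} ∩ {y | t < blockInfo P y})
      ≤ ∑ _m : Fin M, Real.exp (-t) := Finset.sum_le_sum fun m _ => ?_
    _ = M * Real.exp (-t) := by simp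
  by_cases h : t < blockInfo P (c.dec m)
  · refine (measureReal_mono Set.inter_subset_left).trans
      ((iidSource_real_singleton_le P _).trans (Real.exp_le_exp.2 (by linarith)))
  · have : ({c.dec m} ∩ {y | t < blockInfo P y} : Set (Fin n → ℕ)) = ∅ := by
      ext y
      simp only [Set.mem_inter_iff, Set.mem_singleton_iff, Set.mem_ofPred_eq,
        Set.mem_empty_iff_false, iff_false, not_and]
      rintro rfl
      exact h
    rw [this, measureReal_empty]
    positivity

theorem exists_code_error_le_blockInfo_tail (P₁ P₂ : PMF ℕ) (n : ℕ) {t : ℝ} (ht : 0 ≤ t) :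
    ∃ (M : ℕ) (c : Code n M), (M : ℝ) ≤ 3 * Real.exp t ∧
      (iidSource P₁ n).real {y | y ≠ c.dec (c.enc y)} ≤
        (iidSource P₁ n).real {y | t < blockInfo P₁ y} ∧
      (iidSource P₂ n).real {y | y ≠ c.dec (c.enc y)} ≤
        (iidSource P₂ n).real {y | t < blockInfo P₂ y} := by
  classical
  obtain ⟨F₁, hF₁⟩ := exists_finset_mem_iff_le_measureReal (iidSource P₁ n) (Real.exp_pos (-t))
  obtain ⟨F₂, hF₂⟩ := exists_finset_mem_iff_le_measureReal (iidSource P₂ n) (Real.exp_pos (-t))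
  -- The zero block only keeps the codebook nonempty. The size is at most `e^t + e^t + 1`, and `0 ≤
  -- t` turns this into `3 e^t`.
  obtain ⟨c, hc⟩ := exists_code_of_finset (insert 0 (F₁ ∪ F₂)) (Finset.insert_nonempty _ _)
  have hcard : ∀ (P : PMF ℕ) (F : Finset (Fin n → ℕ)),
      (∀ y, y ∈ F ↔ Real.exp (-t) ≤ (iidSource P n).real {y}) → (F.card : ℝ) ≤ Real.exp t := by
    intro P F hF
    have := card_mul_le_one (iidSource P n) F fun y hy => (hF y).1 hy
    rwa [Real.exp_neg, ← div_eq_mul_inv, div_le_one (Real.exp_pos t)] at this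
  have herr : ∀ (P : PMF ℕ) (F : Finset (Fin n → ℕ)), F ⊆ insert 0 (F₁ ∪ F₂) →
      (∀ y, y ∈ F ↔ Real.exp (-t) ≤ (iidSource P n).real {y}) →
      (iidSource P n).real {y | y ≠ c.dec (c.enc y)} ≤
        (iidSource P n).real {y | t < blockInfo P y} := by
    intro P F hsub hF
    have hnull : (iidSource P n).real {y | ¬ ∀ k, P (y k) ≠ 0} = 0 := by
      rw [measureReal_def, iidSource_ae_ne_zero, ENNReal.toReal_zero]
    have hs : {y : Fin n → ℕ | y ≠ c.dec (c.enc y)} ⊆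
        {y | t < blockInfo P y} ∪ {y | ¬ ∀ k, P (y k) ≠ 0} := by
      intro y hy
      by_contra hcon
      simp only [Set.mem_union, Set.mem_ofPred_eq, not_or, not_lt, not_not] at hcon
      refine hy (hc y (hsub ((hF y).2 ?_))).symm
      rw [iidSource_real_singleton_eq_exp P y hcon.2]
      exact Real.exp_le_exp.2 (by linarith [hcon.1])
    have h1 := (measureReal_mono (μ := iidSource P n) hs).trans (measureReal_union_le _ _)
    linarith
  refine ⟨_, c, ?_, herr P₁ F₁ ?_ hF₁, herr P₂ F₂ ?_ hF₂⟩
  · have h1 := hcard P₁ F₁ hF₁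
    have h2 := hcard P₂ F₂ hF₂
    have h3 : ((insert 0 (F₁ ∪ F₂)).card : ℝ) ≤ F₁.card + F₂.card + 1 := by
      exact_mod_cast (Finset.card_insert_le _ _).trans
        (Nat.add_le_add_right (Finset.card_union_le _ _) 1)
    have := Real.one_le_exp ht
    linarith
  · exact Finset.subset_union_left.trans (Finset.subset_insert _ _)
  · exact Finset.subset_union_right.trans (Finset.subset_insert _ _)

theorem errorProb_mixedSource {w₁ w₂ : ℝ} (hw₁ : 0 ≤ w₁) (hw₂ : 0 ≤ w₂) (P₁ P₂ : PMF ℕ)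
    {n M : ℕ} (c : Code n M) :
    c.errorProb (mixedSource w₁ w₂ (iidSource P₁) (iidSource P₂) n) =
      ENNReal.ofReal (w₁ * (iidSource P₁ n).real {y | y ≠ c.dec (c.enc y)} +
        w₂ * (iidSource P₂ n).real {y | y ≠ c.dec (c.enc y)}) := by
  rw [ENNReal.ofReal_add (by positivity) (by positivity), ENNReal.ofReal_mul hw₁,
    ENNReal.ofReal_mul hw₂, ofReal_measureReal, ofReal_measureReal]
  simp [Code.errorProb, mixedSource]

/-! ### Limits of the information spectrum of a memoryless source -/

theorem integrable_toMeasure_of_summable {P : PMF ℕ} {f : ℕ → ℝ}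
    (h : Summable fun y => (P y).toReal * ‖f y‖) : Integrable f P.toMeasure := by
  refine ⟨(measurable_of_countable f).aestronglyMeasurable, ?_⟩
  rw [HasFiniteIntegral, lintegral_countable']
  have hterm : ∀ y, ‖f y‖ₑ * P.toMeasure {y} = ENNReal.ofReal ((P y).toReal * ‖f y‖) := by
    intro y
    rw [PMF.toMeasure_apply_singleton _ _ (measurableSet_singleton y),
      ENNReal.ofReal_mul ENNReal.toReal_nonneg, ENNReal.ofReal_toReal (P.apply_ne_top y),
      ofReal_norm, mul_comm]
  simp_rw [hterm]
  rw [← ENNReal.ofReal_tsum_of_nonneg (fun y => by positivity) h]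
  exact ENNReal.ofReal_lt_top

theorem FiniteVarentropy.memLp {P : PMF ℕ} (hV : FiniteVarentropy P) :
    MemLp (selfInfo P) 2 P.toMeasure := by
  have hmeas : ∀ g : ℕ → ℝ, AEStronglyMeasurable g P.toMeasure := fun g =>
    (measurable_of_countable g).aestronglyMeasurable
  -- Here `entropy P` is just some constant (possibly the default `0` of a divergent sum). Adding it
  -- back stays in `L²`, and convergence of the entropy series follows.
  have h : MemLp (fun y => selfInfo P y - entropy P) 2 P.toMeasure := by
    rw [memLp_two_iff_integrable_sq (hmeas _)]
    refine integrable_toMeasure_of_summable (hV.congr fun y => ?_)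
    rw [Real.norm_of_nonneg (sq_nonneg _)]
  have := h.add (memLp_const (entropy P))
  refine this.congr_norm (hmeas _) (Eventually.of_forall fun y => ?_)
  simp

theorem FiniteVarentropy.integral_selfInfo {P : PMF ℕ} (hV : FiniteVarentropy P) :
    ∫ y, selfInfo P y ∂P.toMeasure = entropy P := by
  rw [PMF.integral_eq_tsum _ _ (hV.memLp.integrable one_le_two)]
  rfl

theorem FiniteVarentropy.variance_selfInfo {P : PMF ℕ} (hV : FiniteVarentropy P) :
    Var[selfInfo P; P.toMeasure] = varentropy P := by
  rw [variance_eq_integral (measurable_of_countable _).aemeasurable, hV.integral_selfInfo,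
    PMF.integral_eq_tsum]
  · rfl
  · exact (hV.memLp.sub (memLp_const (entropy P))).integrable_sq

theorem varentropy_nonneg (P : PMF ℕ) : 0 ≤ varentropy P :=
  tsum_nonneg fun _ => mul_nonneg ENNReal.toReal_nonneg (sq_nonneg _)

theorem selfInfo_nonneg (P : PMF ℕ) (y : ℕ) : 0 ≤ selfInfo P y := by
  rw [selfInfo, one_div, Real.log_inv]
  have h : (P y).toReal ≤ 1 :=
    ENNReal.toReal_le_of_le_ofReal zero_le_one (by simpa using P.coe_le_one y)
  linarith [Real.log_nonpos ENNReal.toReal_nonneg h]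

theorem entropy_nonneg (P : PMF ℕ) : 0 ≤ entropy P :=
  tsum_nonneg fun y => mul_nonneg ENNReal.toReal_nonneg (selfInfo_nonneg P y)

/-- A nonnegative variable with zero mean is a.e. zero, hence has no variance. Positivity of the
entropy later makes the threshold `n a + √n γ` eventually nonnegative. -/
theorem FiniteVarentropy.entropy_pos {P : PMF ℕ} (hV : FiniteVarentropy P)
    (hσ : 0 < stdDev P) : 0 < entropy P := by
  refine (entropy_nonneg P).lt_of_ne' fun h => ?_
  rw [← hV.integral_selfInfo, integral_eq_zero_iff_of_nonneg (selfInfo_nonneg P)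
    (hV.memLp.integrable one_le_two)] at h
  have := variance_congr h
  rw [hV.variance_selfInfo, variance_zero] at this
  rw [stdDev, this, Real.sqrt_zero] at hσ
  exact hσ.false

/-- Puts all block lengths on one probability space, so that the central limit theorem applies to
one i.i.d. sequence. -/
theorem iidSource_eq_map (P : PMF ℕ) (n : ℕ) :
    iidSource P n = (Measure.infinitePi fun _ : ℕ => P.toMeasure).map
      (fun ω (k : Fin n) => ω k) := by
  rw [Measure.map_infinitePi_infinitePi_of_inj (f := fun k : Fin n => (k : ℕ))
    Fin.val_injective, Measure.infinitePi_eq_pi]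
  rfl

theorem gaussianReal_Ioi_eq_gaussianTail {σ : ℝ} (hσ : 0 < σ) (γ : ℝ) :
    (gaussianReal 0 (σ ^ 2).toNNReal).real (Set.Ioi γ) =
      gaussianTail ((γ : EReal) / (σ : EReal)) := by
  have hmap := gaussianReal_map_const_mul (μ := 0) (v := 1) σ
  rw [mul_zero, mul_one] at hmap
  rw [← Real.toNNReal_of_nonneg (sq_nonneg σ)] at hmap
  have := nullSingletonClass_gaussianReal (μ := 0) (v := 1) one_ne_zero
  have hpre : (fun z : ℝ => σ * z) ⁻¹' Set.Ioi γ = Set.Ioi (γ / σ) := by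
    ext z
    simp [div_lt_iff₀' hσ]
  rw [← hmap, map_measureReal_apply (by fun_prop) measurableSet_Ioi, hpre, ← EReal.coe_div,
    gaussianTail_coe]
  exact measureReal_congr Ioi_ae_eq_Ici

theorem tendsto_blockInfo_tail {P : PMF ℕ} (hV : FiniteVarentropy P) (hσ : 0 < stdDev P)
    (γ : ℝ) :
    Tendsto (fun n : ℕ => (iidSource P n).real
        {y | n * entropy P + Real.sqrt n * γ < blockInfo P y}) atTop
      (𝓝 (gaussianTail ((γ : EReal) / (stdDev P : EReal)))) := by
  let ν : Measure (ℕ → ℕ) := Measure.infinitePi fun _ : ℕ => P.toMeasure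
  let X : ℕ → (ℕ → ℕ) → ℝ := fun k ω => selfInfo P (ω k)
  have hself : Measurable (selfInfo P) := measurable_of_countable _
  have hX : ∀ k, Measurable (X k) := fun k => hself.comp (measurable_pi_apply k)
  have hmapX : ∀ k, ν.map (X k) = P.toMeasure.map (selfInfo P) := by
    intro k
    rw [← Measure.infinitePi_map_eval (fun _ : ℕ => P.toMeasure) k,
      Measure.map_map hself (by fun_prop)]
    rfl
  have hmp : MeasurePreserving (fun ω : ℕ → ℕ => ω 0) ν P.toMeasure :=
    ⟨measurable_pi_apply 0, Measure.infinitePi_map_eval _ 0⟩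
  have hindep : iIndepFun X ν := iIndepFun_infinitePi (fun _ => hself)
  have hident : ∀ k, IdentDistrib (X k) (X 0) ν ν := fun k =>
    ⟨(hX k).aemeasurable, (hX 0).aemeasurable, by rw [hmapX, hmapX]⟩
  have hmem : MemLp (X 0) 2 ν := hV.memLp.comp_measurePreserving hmp
  have hmean : ∫ ω, X 0 ω ∂ν = entropy P := by
    rw [← hV.integral_selfInfo, ← hmp.map_eq, integral_map hmp.measurable.aemeasurable
      hself.aestronglyMeasurable]
  have hvar : Var[X 0; ν] = (stdDev P) ^ 2 := by
    rw [stdDev, Real.sq_sqrt (varentropy_nonneg P), ← hV.variance_selfInfo]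
    exact hmp.variance_fun_comp hself.aemeasurable
  have hlaw : HasLaw (fun x : ℝ => x) (gaussianReal 0 Var[X 0; ν].toNNReal)
      (gaussianReal 0 Var[X 0; ν].toNNReal) := ⟨by fun_prop, Measure.map_id⟩
  have hclt := (tendstoInDistribution_inv_sqrt_mul_sum_sub hlaw hmem hindep hident).tendsto
  have hv0 : Var[X 0; ν].toNNReal ≠ 0 := by
    rw [hvar]
    simpa using hσ.ne'
  have := nullSingletonClass_gaussianReal (μ := 0) hv0
  -- The boundary `{γ}` of the half-line is null because `σ > 0` makes the Gaussian limit
  -- nondegenerate.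
  have hlim := ProbabilityMeasure.tendsto_measure_of_null_frontier_of_tendsto' hclt
    (E := Set.Ioi γ) (by
      rw [frontier_Ioi]
      simp only [ProbabilityMeasure.coe_mk, Measure.map_id']
      exact measure_singleton γ)
  simp only [ProbabilityMeasure.coe_mk, Measure.map_id'] at hlim
  have hreal := (ENNReal.tendsto_toReal (measure_ne_top _ _)).comp hlim
  rw [← gaussianReal_Ioi_eq_gaussianTail hσ, ← hvar]
  refine hreal.congr' ?_
  filter_upwards [eventually_gt_atTop 0] with n hn
  have hn' : 0 < Real.sqrt n := Real.sqrt_pos.2 (by exact_mod_cast hn)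
  have hsum : Measurable fun ω => (Real.sqrt n)⁻¹ *
      (∑ k ∈ Finset.range n, X k ω - n * ∫ ω, X 0 ω ∂ν) :=
    ((Finset.measurable_fun_sum _ fun k _ => hX k).sub_const _).const_mul _
  rw [iidSource_eq_map, map_measureReal_apply (by fun_prop) (Set.to_countable _).measurableSet]
  simp only [Function.comp_apply]
  rw [Measure.map_apply hsum measurableSet_Ioi, measureReal_def]
  congr 2
  ext ω
  simp only [Set.mem_preimage, Set.mem_Ioi, Set.mem_ofPred_eq, hmean, blockInfo]
  rw [← Fin.sum_univ_eq_sum_range (fun k => X k ω) n, inv_mul_eq_div, lt_div_iff₀ hn',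
    lt_sub_iff_add_lt', mul_comm γ]

theorem tendsto_blockInfo_deviation {P : PMF ℕ} (hV : FiniteVarentropy P) {δ : ℝ} (hδ : 0 < δ) :
    Tendsto (fun n : ℕ => (iidSource P n).real {y | n * δ ≤ |blockInfo P y - n * entropy P|})
      atTop (𝓝 0) := by
  have hbound : ∀ᶠ n : ℕ in atTop,
      (iidSource P n).real {y | n * δ ≤ |blockInfo P y - n * entropy P|} ≤
        varentropy P / δ ^ 2 / n := by
    filter_upwards [eventually_gt_atTop 0] with n hn
    have hn' : (0 : ℝ) < n := by exact_mod_cast hn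
    have hmemk : ∀ k : Fin n, MemLp (fun y : Fin n → ℕ => selfInfo P (y k)) 2 (iidSource P n) :=
      fun k => hV.memLp.comp_measurePreserving
        (measurePreserving_eval (fun _ : Fin n => P.toMeasure) k)
    have hblock : (fun y : Fin n → ℕ => blockInfo P y) =
        ∑ k, fun y : Fin n → ℕ => selfInfo P (y k) := by
      ext y
      simp [blockInfo]
    have hmem : MemLp (fun y : Fin n → ℕ => blockInfo P y) 2 (iidSource P n) :=
      memLp_finsetSum _ fun k _ => hmemk k
    have hvar : Var[fun y : Fin n → ℕ => blockInfo P y; iidSource P n] = n * varentropy P := by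
      rw [hblock, iidSource, variance_sum_pi (μ := fun _ : Fin n => P.toMeasure)
        (X := fun _ => selfInfo P) fun _ => hV.memLp]
      simp [hV.variance_selfInfo]
    have hmean : ∫ y, blockInfo P y ∂(iidSource P n) = n * entropy P := by
      simp only [blockInfo]
      rw [integral_finsetSum _ fun k _ => (hmemk k).integrable one_le_two]
      have : ∀ k : Fin n, ∫ y : Fin n → ℕ, selfInfo P (y k) ∂(iidSource P n) = entropy P := by
        intro k
        rw [← hV.integral_selfInfo,
          ← (measurePreserving_eval (fun _ : Fin n => P.toMeasure) k).map_eq,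
          integral_map (measurable_pi_apply k).aemeasurable
            (measurable_of_countable _).aestronglyMeasurable]
        rfl
      simp [this]
    have hcheb := meas_ge_le_variance_div_sq hmem (mul_pos hn' hδ)
    rw [hvar, hmean] at hcheb
    have := ENNReal.toReal_le_of_le_ofReal
      (div_nonneg (mul_nonneg hn'.le (varentropy_nonneg P)) (sq_nonneg _)) hcheb
    refine this.trans_eq ?_
    field_simp
  exact squeeze_zero' (Eventually.of_forall fun n => measureReal_nonneg) hbound
    (tendsto_const_div_atTop_nhds_zero_nat _)

theorem tendsto_sqrt_natCast_atTop : Tendsto (fun n : ℕ => Real.sqrt n) atTop atTop :=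
  Real.tendsto_sqrt_atTop.comp tendsto_natCast_atTop_atTop

theorem eventually_abs_sqrt_mul_le (γ : ℝ) {δ : ℝ} (hδ : 0 < δ) :
    ∀ᶠ n : ℕ in atTop, |Real.sqrt n * γ| ≤ n * δ := by
  filter_upwards [tendsto_sqrt_natCast_atTop.eventually_ge_atTop (|γ| / δ)] with n hn
  rw [div_le_iff₀ hδ] at hn
  rw [abs_mul, abs_of_nonneg (Real.sqrt_nonneg _)]
  calc Real.sqrt n * |γ| ≤ Real.sqrt n * (Real.sqrt n * δ) := by gcongr
    _ = n * δ := by rw [← mul_assoc, Real.mul_self_sqrt (Nat.cast_nonneg n)]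

theorem tendsto_blockInfo_tail_zero {P : PMF ℕ} (hV : FiniteVarentropy P) {a : ℝ}
    (ha : entropy P < a) (γ : ℝ) :
    Tendsto (fun n : ℕ => (iidSource P n).real
        {y | n * a + Real.sqrt n * γ < blockInfo P y}) atTop (𝓝 0) := by
  -- Half of the gap absorbs the shift `√n γ`; the other half is left as a linear deviation, to
  -- which Chebyshev applies.
  have hδ : 0 < (a - entropy P) / 2 := by linarith
  refine squeeze_zero' (Eventually.of_forall fun n => measureReal_nonneg) ?_
    (tendsto_blockInfo_deviation hV hδ)
  filter_upwards [eventually_abs_sqrt_mul_le γ hδ] with n hn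
  refine measureReal_mono fun y hy => ?_
  simp only [Set.mem_ofPred_eq] at hy ⊢
  have := neg_abs_le (Real.sqrt n * γ)
  exact le_trans (by linarith) (le_abs_self _)

theorem tendsto_blockInfo_tail_one {P : PMF ℕ} (hV : FiniteVarentropy P) {a : ℝ}
    (ha : a < entropy P) (γ : ℝ) :
    Tendsto (fun n : ℕ => (iidSource P n).real
        {y | n * a + Real.sqrt n * γ < blockInfo P y}) atTop (𝓝 1) := by
  have hδ : 0 < (entropy P - a) / 2 := by linarith
  have hlim := (tendsto_blockInfo_deviation hV hδ).const_sub 1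
  rw [sub_zero] at hlim
  refine tendsto_of_tendsto_of_tendsto_of_le_of_le' hlim tendsto_const_nhds ?_
    (Eventually.of_forall fun n => measureReal_le_one)
  filter_upwards [eventually_abs_sqrt_mul_le γ hδ] with n hn
  rw [← probReal_compl_eq_one_sub (Set.to_countable _).measurableSet]
  refine measureReal_mono fun y hy => ?_
  simp only [Set.mem_compl_iff, Set.mem_ofPred_eq, not_le] at hy ⊢
  have := le_abs_self (Real.sqrt n * γ)
  have := (abs_lt.1 hy).1
  linarith

/-! ### The second-order rate of a mixture of two memoryless sources -/

theorem achievable_of_tendsto {P₁ P₂ : PMF ℕ} {w₁ w₂ a ε γ q₁ q₂ : ℝ} (hw₁ : 0 ≤ w₁)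
    (hw₂ : 0 ≤ w₂) (ha : 0 < a)
    (h₁ : Tendsto (fun n : ℕ => (iidSource P₁ n).real
        {y | n * a + Real.sqrt n * γ < blockInfo P₁ y}) atTop (𝓝 q₁))
    (h₂ : Tendsto (fun n : ℕ => (iidSource P₂ n).real
        {y | n * a + Real.sqrt n * γ < blockInfo P₂ y}) atTop (𝓝 q₂))
    (hq : w₁ * q₁ + w₂ * q₂ ≤ ε) :
    Achievable (mixedSource w₁ w₂ (iidSource P₁) (iidSource P₂)) a ε γ := by
  -- The code bound needs a nonnegative threshold; the truncation at `0` is inactive for large `n`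
  -- since `a > 0`.
  choose M c hM he₁ he₂ using fun n : ℕ => exists_code_error_le_blockInfo_tail P₁ P₂ n
    (le_max_right (n * a + Real.sqrt n * γ) 0)
  have hmono : ∀ (P : PMF ℕ) (n : ℕ),
      (iidSource P n).real {y | max (n * a + Real.sqrt n * γ) 0 < blockInfo P y} ≤
        (iidSource P n).real {y | n * a + Real.sqrt n * γ < blockInfo P y} := fun P n =>
    measureReal_mono fun y hy => (le_max_left _ _).trans_lt (Set.mem_ofPred.1 hy)
  refine ⟨M, c, ?_, ?_⟩
  · have hlim := ENNReal.tendsto_ofReal ((h₁.const_mul w₁).add (h₂.const_mul w₂))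
    calc limsup (fun n : ℕ => (c n).errorProb _) atTop
        ≤ limsup (fun n : ℕ => ENNReal.ofReal
            (w₁ * (iidSource P₁ n).real {y | n * a + Real.sqrt n * γ < blockInfo P₁ y} +
            w₂ * (iidSource P₂ n).real {y | n * a + Real.sqrt n * γ < blockInfo P₂ y})) atTop := by
          refine limsup_le_limsup (Eventually.of_forall fun n => ?_)
          simp only [errorProb_mixedSource hw₁ hw₂]
          refine ENNReal.ofReal_le_ofReal (add_le_add ?_ ?_)
          · exact mul_le_mul_of_nonneg_left ((he₁ n).trans (hmono P₁ n)) hw₁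
          · exact mul_le_mul_of_nonneg_left ((he₂ n).trans (hmono P₂ n)) hw₂
      _ = ENNReal.ofReal (w₁ * q₁ + w₂ * q₂) := hlim.limsup_eq
      _ ≤ ENNReal.ofReal ε := ENNReal.ofReal_le_ofReal hq
  -- The factor `3` in the codebook size costs only `log 3 / √n` in the rate.
  · have hlim : Tendsto (fun n : ℕ => ((γ + Real.log 3 / Real.sqrt n : ℝ) : EReal)) atTop
        (𝓝 (γ : EReal)) := by
      refine (continuous_coe_real_ereal.tendsto γ).comp ?_
      simpa using (tendsto_sqrt_natCast_atTop.const_div_atTop (Real.log 3)).const_add γ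
    rw [← hlim.limsup_eq]
    refine limsup_le_limsup ?_
    filter_upwards [eventually_abs_sqrt_mul_le γ ha, eventually_gt_atTop 0] with n hn hn0
    have hs : 0 < Real.sqrt n := Real.sqrt_pos.2 (by exact_mod_cast hn0)
    refine EReal.coe_le_coe_iff.2 ?_
    have hMpos : (0 : ℝ) < M n := by exact_mod_cast (c n).pos
    have hmax : max (n * a + Real.sqrt n * γ) 0 = n * a + Real.sqrt n * γ :=
      max_eq_left (by linarith [neg_abs_le (Real.sqrt n * γ)])
    have hlog : Real.log (M n) ≤ Real.log 3 + (n * a + Real.sqrt n * γ) := by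
      have := Real.log_le_log hMpos (hM n)
      rwa [hmax, Real.log_mul (by norm_num) (Real.exp_ne_zero _), Real.log_exp] at this
    rw [Real.log_div hMpos.ne' (Real.exp_ne_zero _), Real.log_exp, one_div_mul_eq_div,
      div_le_iff₀ hs, add_mul, div_mul_cancel₀ _ hs.ne']
    linarith

theorem Achievable.le_of_tendsto {P₁ P₂ : PMF ℕ} {w₁ w₂ a ε R γ q₁ q₂ : ℝ} (hw₁ : 0 ≤ w₁)
    (hw₂ : 0 ≤ w₂) (hε : 0 ≤ ε)
    (hR : Achievable (mixedSource w₁ w₂ (iidSource P₁) (iidSource P₂)) a ε R) (hγ : R < γ)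
    (h₁ : Tendsto (fun n : ℕ => (iidSource P₁ n).real
        {y | n * a + Real.sqrt n * γ < blockInfo P₁ y}) atTop (𝓝 q₁))
    (h₂ : Tendsto (fun n : ℕ => (iidSource P₂ n).real
        {y | n * a + Real.sqrt n * γ < blockInfo P₂ y}) atTop (𝓝 q₂)) :
    w₁ * q₁ + w₂ * q₂ ≤ ε := by
  obtain ⟨M, c, herr, hrate⟩ := hR
  -- Eventually `M n` is below `exp (n a + √n γ')`, so the covering term at threshold `γ` is at most
  -- `exp (-√n (γ - γ'))` and vanishes.
  obtain ⟨γ', hRγ', hγ'⟩ := exists_between hγ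
  have hev := eventually_lt_of_limsup_lt (hrate.trans_lt (EReal.coe_lt_coe_iff.2 hRγ'))
  have hM : ∀ᶠ n : ℕ in atTop, (M n : ℝ) * Real.exp (-(n * a + Real.sqrt n * γ)) ≤
      Real.exp (-(Real.sqrt n * (γ - γ'))) := by
    filter_upwards [hev, eventually_gt_atTop 0] with n hn hn0
    have hs : 0 < Real.sqrt n := Real.sqrt_pos.2 (by exact_mod_cast hn0)
    have hMpos : (0 : ℝ) < M n := by exact_mod_cast (c n).pos
    have hlog := EReal.coe_lt_coe_iff.1 hn
    rw [Real.log_div hMpos.ne' (Real.exp_ne_zero _), Real.log_exp, one_div_mul_eq_div,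
      div_lt_iff₀ hs] at hlog
    nth_rewrite 1 [← Real.exp_log hMpos]
    rw [← Real.exp_add]
    exact Real.exp_le_exp.2 (by linarith)
  have hrem : Tendsto (fun n : ℕ => (M n : ℝ) * Real.exp (-(n * a + Real.sqrt n * γ))) atTop
      (𝓝 0) := by
    refine squeeze_zero' (Eventually.of_forall fun n => by positivity) hM ?_
    exact Real.tendsto_exp_neg_atTop_nhds_zero.comp
      (tendsto_sqrt_natCast_atTop.atTop_mul_const (sub_pos.2 hγ'))
  have hlim := ENNReal.tendsto_ofReal
    (((h₁.sub hrem).const_mul w₁).add ((h₂.sub hrem).const_mul w₂))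
  rw [sub_zero, sub_zero] at hlim
  rw [← ENNReal.ofReal_le_ofReal_iff hε, ← hlim.limsup_eq]
  refine (limsup_le_limsup (Eventually.of_forall fun n => ?_)).trans herr
  simp only [errorProb_mixedSource hw₁ hw₂]
  refine ENNReal.ofReal_le_ofReal (add_le_add ?_ ?_)
  · exact mul_le_mul_of_nonneg_left
      (by linarith [blockInfo_tail_le_error_add P₁ (c n) (n * a + Real.sqrt n * γ)]) hw₁
  · exact mul_le_mul_of_nonneg_left
      (by linarith [blockInfo_tail_le_error_add P₂ (c n) (n * a + Real.sqrt n * γ)]) hw₂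

/-- Every real `γ > T` is achievable, and an achievable `R < T` would leave a real `γ` strictly
between them whose limiting error exceeds `ε`. Only real `γ` are tested, so `T = ±∞` needs no
separate case. -/
theorem codingRate_mixedSource_eq {P₁ P₂ : PMF ℕ} {w₁ w₂ a ε : ℝ} (hw₁ : 0 ≤ w₁)
    (hw₂ : 0 ≤ w₂) (ha : 0 < a) (hε : 0 ≤ ε) {q₁ q₂ : EReal → ℝ}
    (h₁ : ∀ γ : ℝ, Tendsto (fun n : ℕ => (iidSource P₁ n).real
        {y | n * a + Real.sqrt n * γ < blockInfo P₁ y}) atTop (𝓝 (q₁ γ)))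
    (h₂ : ∀ γ : ℝ, Tendsto (fun n : ℕ => (iidSource P₂ n).real
        {y | n * a + Real.sqrt n * γ < blockInfo P₂ y}) atTop (𝓝 (q₂ γ)))
    (hq : StrictAnti fun T => w₁ * q₁ T + w₂ * q₂ T) {T : EReal}
    (hT : ε = w₁ * q₁ T + w₂ * q₂ T) :
    codingRate (mixedSource w₁ w₂ (iidSource P₁) (iidSource P₂)) a ε = T := by
  refine le_antisymm (EReal.le_of_forall_lt_iff_le.1 fun γ hγ => ?_) ?_
  · refine sInf_le ⟨γ, ?_, rfl⟩
    exact achievable_of_tendsto hw₁ hw₂ ha (h₁ γ) (h₂ γ) (hT ▸ (hq hγ).le)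
  · refine le_sInf ?_
    rintro _ ⟨R, hR, rfl⟩
    by_contra hlt
    obtain ⟨γ, hRγ, hγT⟩ := EReal.lt_iff_exists_real_btwn.1 (not_le.1 hlt)
    have hle := Achievable.le_of_tendsto hw₁ hw₂ hε hR (EReal.coe_lt_coe_iff.1 hRγ)
      (h₁ γ) (h₂ γ)
    have hgt := hq hγT
    simp only [← hT] at hgt
    linarith

end FixedLengthCoding

theorem theorem7 (P₁ P₂ : PMF ℕ) (w₁ w₂ : ℝ) (hw₁ : 0 < w₁) (hw₂ : 0 < w₂) (hw : w₁ + w₂ = 1)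
    (hV₁ : FiniteVarentropy P₁) (hV₂ : FiniteVarentropy P₂)
    (ε : ℝ) (hε₀ : 0 ≤ ε) (hε₁ : ε < 1) :
    -- Case I
    (entropy P₁ = entropy P₂ → 0 < stdDev P₁ → 0 < stdDev P₂ →
      (∃! T : EReal, ε = w₁ * gaussianTail (T / (stdDev P₁ : EReal))
          + w₂ * gaussianTail (T / (stdDev P₂ : EReal))) ∧
      ∀ T : EReal, ε = w₁ * gaussianTail (T / (stdDev P₁ : EReal))
          + w₂ * gaussianTail (T / (stdDev P₂ : EReal)) →
        codingRate (mixedSource w₁ w₂ (iidSource P₁) (iidSource P₂)) (entropy P₁) ε = T) ∧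
    -- Case II
    (entropy P₂ < entropy P₁ → ε < w₁ → 0 < stdDev P₁ →
      (∃! T : EReal, ε = w₁ * gaussianTail (T / (stdDev P₁ : EReal))) ∧
      ∀ T : EReal, ε = w₁ * gaussianTail (T / (stdDev P₁ : EReal)) →
        codingRate (mixedSource w₁ w₂ (iidSource P₁) (iidSource P₂)) (entropy P₁) ε = T) ∧
    -- Case III
    (entropy P₂ < entropy P₁ → w₁ < ε → 0 < stdDev P₂ →
      (∃! T : EReal, ε = w₁ + w₂ * gaussianTail (T / (stdDev P₂ : EReal))) ∧
      ∀ T : EReal, ε = w₁ + w₂ * gaussianTail (T / (stdDev P₂ : EReal)) →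
        codingRate (mixedSource w₁ w₂ (iidSource P₁) (iidSource P₂)) (entropy P₂) ε = T) := by
  refine ⟨fun hH hσ₁ hσ₂ => ?_, fun hH hεw hσ₁ => ?_, fun hH hwε hσ₂ => ?_⟩
  · have hanti : StrictAnti fun T : EReal => w₁ * gaussianTail (T / (stdDev P₁ : EReal)) +
        w₂ * gaussianTail (T / (stdDev P₂ : EReal)) :=
      fun s t hst => add_lt_add (mul_lt_mul_of_pos_left (gaussianTail_div_strictAnti hσ₁ hst) hw₁)
        (mul_lt_mul_of_pos_left (gaussianTail_div_strictAnti hσ₂ hst) hw₂)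
    refine ⟨existsUnique_eq_of_strictAnti
      (((gaussianTail_div_continuous hσ₁).const_mul w₁).add
        ((gaussianTail_div_continuous hσ₂).const_mul w₂)) hanti ?_ ?_, fun T hT => ?_⟩
    · simpa [gaussianTail_top_div hσ₁, gaussianTail_top_div hσ₂] using hε₀
    · simpa [gaussianTail_bot_div hσ₁, gaussianTail_bot_div hσ₂, hw] using hε₁.le
    · refine codingRate_mixedSource_eq hw₁.le hw₂.le (hV₁.entropy_pos hσ₁) hε₀
        (tendsto_blockInfo_tail hV₁ hσ₁) ?_ hanti hT
      rw [hH]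
      exact tendsto_blockInfo_tail hV₂ hσ₂
  · have hanti : StrictAnti fun T : EReal => w₁ * gaussianTail (T / (stdDev P₁ : EReal)) :=
      fun s t hst => mul_lt_mul_of_pos_left (gaussianTail_div_strictAnti hσ₁ hst) hw₁
    refine ⟨existsUnique_eq_of_strictAnti ((gaussianTail_div_continuous hσ₁).const_mul w₁)
      hanti ?_ ?_, fun T hT => ?_⟩
    · simpa [gaussianTail_top_div hσ₁] using hε₀
    · simpa [gaussianTail_bot_div hσ₁] using hεw.le
    -- At rate `H(Y₁) > H(Y₂)` the second component is coded with vanishing error.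
    · exact codingRate_mixedSource_eq hw₁.le hw₂.le (hV₁.entropy_pos hσ₁) hε₀ (q₂ := fun _ => 0)
        (tendsto_blockInfo_tail hV₁ hσ₁) (tendsto_blockInfo_tail_zero hV₂ hH)
        (by simpa using hanti) (by simpa using hT)
  · have hanti : StrictAnti fun T : EReal =>
        w₁ + w₂ * gaussianTail (T / (stdDev P₂ : EReal)) :=
      fun s t hst => add_lt_add_right
        (mul_lt_mul_of_pos_left (gaussianTail_div_strictAnti hσ₂ hst) hw₂) w₁
    refine ⟨existsUnique_eq_of_strictAnti
      (((gaussianTail_div_continuous hσ₂).const_mul w₂).const_add w₁) hanti ?_ ?_,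
      fun T hT => ?_⟩
    · simpa [gaussianTail_top_div hσ₂] using hwε.le
    · simpa [gaussianTail_bot_div hσ₂, hw] using hε₁.le
    -- At rate `H(Y₂) < H(Y₁)` the first component is lost entirely, contributing error `w₁`.
    · exact codingRate_mixedSource_eq hw₁.le hw₂.le (hV₂.entropy_pos hσ₂) hε₀ (q₁ := fun _ => 1)
        (tendsto_blockInfo_tail_one hV₁ hH) (tendsto_blockInfo_tail hV₂ hσ₂)
        (by simpa using hanti) (by simpa using hT)
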